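/- Let $\mathbb N=\{0,1,2,\ldots\}$, and let $p_8(x)=x(3x-2)$ for $x\in\mathbb Z$. (i) For every integer $a>1$, $$\left\{\left\lfloor\frac{x^2+y^2+z^2}{a}\right\rfloor:\ x,y,z\in\mathbb Z\right\}=\mathbb N \quad\text{and}\quad \left\{\left\lfloor\frac{x(x+1)+y(y+1)+z(z+1)}{a}\right\rfloor:\ x,y,z\in\mathbb Z\right\}=\mathbb N.$$ (ii) Let $a$ be a positive integer. If $a$ is odd, then every $n\in\mathbb N$ can be written as $x^2+y^2+z^2+\left\lfloor\frac a2(x+y+z)\right\rfloor$ with $x,y,z\in\mathbb Z$. If $3\nmid a$, then every $n\in\mathbb N$ can be written as $x^2+y^2+z^2+\left\lfloor\frac a3(x+y+z)\right\rfloor$ with $x,y,z\in\mathbb Z$. (iii) For every $n\in\mathbb N$ there are $x,y,z\in\mathbb Z$ such that $$n=\frac{p_8(x)}2+\left\lceil\frac{p_8(y)}2\right\rceil+\left\lceil\frac{p_8(z)}2\right\rceil.$$ Moreover, the function $s(x):=\left\lceil\frac{p_8(-x)}2\right\rceil$ satisfies $s(x)=x+\left\lceil\frac32x^2\right\rceil$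 for all $x\in\mathbb Z$, and $$\{s(x)+s(y)+s(z):\ x,y,z\in\mathbb Z\}=\mathbb N.$$ -/

import Mathlib

/-- The generalized octagonal numbers `p₈(x) = x(3x - 2)`, `x ∈ ℤ`. -/
def p8 (x : ℤ) : ℤ := x * (3 * x - 2)

/-- `s(x) = ⌈p₈(-x) / 2⌉`, with exact (rational) division by `2`. -/
def sFun (x : ℤ) : ℤ := ⌈(p8 (-x) : ℚ) / 2⌉

/-! Completing squares turns each claim into a sum of three squares whose entries satisfy
congruences; the rounding leaves a small remainder free, chosen so that the sum is 1 or 2 mod 4, or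
3 mod 8. For these classes `isSumThreeSq_of_mod_eight` applies: Hermite reduction shows that a
positive ternary form of determinant one is a sum of three squares, and Dirichlet's theorem with
reciprocity builds such a form representing `n`. Entries prime to 3 come from a descent by 9
(`exists_coprime_three`). -/

/-- The integer `n` is a sum of three integer squares. -/
def IsSumThreeSq (n : ℤ) : Prop := ∃ x y z : ℤ, n = x ^ 2 + y ^ 2 + z ^ 2

/-! ### Hermite reduction of unimodular ternary forms -/

/-- The ternary quadratic form with Gram matrix `!![a, b, c; b, d, e; c, e, f]` is positive definite
with determinant one and represents `n`. -/
structure UnimodularTernaryRep (n a b c d e f : ℤ) : Prop where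
  pos : 0 < a
  minor_pos : 0 < a * d - b ^ 2
  det : a * (d * f - e ^ 2) - b * (b * f - c * e) + c * (b * e - c * d) = 1
  rep : ∃ x y z : ℤ,
    n = a * x ^ 2 + d * y ^ 2 + f * z ^ 2 + 2 * b * x * y + 2 * c * x * z + 2 * e * y * z

namespace UnimodularTernaryRep

variable {n a b c d e f : ℤ}

theorem shear_left (h : UnimodularTernaryRep n a b c d e f) (k : ℤ) :
    UnimodularTernaryRep n a (b + k * a) c (d + 2 * k * b + k ^ 2 * a) (e + k * c) f := by
  obtain ⟨h1, h2, h3, x, y, z, h4⟩ := h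
  exact ⟨h1, by linarith, by linear_combination h3,
    x - k * y, y, z, by linear_combination h4⟩

theorem shear_right (h : UnimodularTernaryRep n a b c d e f) (k : ℤ) :
    UnimodularTernaryRep n a b (c + k * b) d (e + k * d) (f + 2 * k * e + k ^ 2 * d) := by
  obtain ⟨h1, h2, h3, x, y, z, h4⟩ := h
  exact ⟨h1, h2, by linear_combination h3, x, y - k * z, z, by linear_combination h4⟩

/-- The Gram determinant of the projection orthogonal to the first basis vector. -/
theorem minor_identity (h : UnimodularTernaryRep n a b c d e f) :
    (a * d - b ^ 2) * (a * f - c ^ 2) = a + (a * e - b * c) ^ 2 := by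
  linear_combination a * h.det

theorem swap_right (h : UnimodularTernaryRep n a b c d e f) :
    UnimodularTernaryRep n a c b f e d := by
  have hm := h.minor_identity
  obtain ⟨h1, h2, h3, x, y, z, h4⟩ := h
  refine ⟨h1, ?_, by linear_combination h3, x, z, y, by linear_combination h4⟩
  exact pos_of_mul_pos_right (hm ▸ by positivity) h2.le

theorem swap_left (h : UnimodularTernaryRep n a b c d e f) :
    UnimodularTernaryRep n d b e a c f := by
  obtain ⟨h1, h2, h3, x, y, z, h4⟩ := h
  refine ⟨?_, by linarith, by linear_combination h3, y, x, z, by linear_combination h4⟩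
  exact pos_of_mul_pos_right (show 0 < a * d by nlinarith [sq_nonneg b]) h1.le

end UnimodularTernaryRep

theorem Int.exists_abs_two_mul_add_mul_le {a : ℤ} (ha : 0 < a) (b : ℤ) :
    ∃ k : ℤ, |2 * (b + k * a)| ≤ a := by
  refine ⟨-((2 * b + a) / (2 * a)), ?_⟩
  have h1 := Int.emod_add_mul_ediv (2 * b + a) (2 * a)
  have h2 := Int.emod_nonneg (2 * b + a) (b := 2 * a) (by positivity)
  have h3 := Int.emod_lt_of_pos (2 * b + a) (b := 2 * a) (by positivity)
  rw [abs_le]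
  constructor <;> linarith

/-- A form that is reduced in the sense of Hermite is a sum of three squares. -/
theorem UnimodularTernaryRep.isSumThreeSq_of_reduced {n a b c d e f : ℤ}
    (h : UnimodularTernaryRep n a b c d e f) (hb : |2 * b| ≤ a) (had : a ≤ d)
    (hg : |2 * (a * e - b * c)| ≤ a * d - b ^ 2) (hgg : a * d - b ^ 2 ≤ a * f - c ^ 2) :
    IsSumThreeSq n := by
  have hm := h.minor_identity
  obtain ⟨ha, h2, h3, x, y, z, h4⟩ := h
  set g := a * d - b ^ 2 with hgdef
  have hb2 : 4 * b ^ 2 ≤ a ^ 2 := by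
    have := sq_le_sq' (abs_le.mp hb).1 (abs_le.mp hb).2
    linarith
  have hg2 : 4 * (a * e - b * c) ^ 2 ≤ g ^ 2 := by
    have := sq_le_sq' (abs_le.mp hg).1 (abs_le.mp hg).2
    linarith
  -- By `hm`, g² ≤ a + g²/4; likewise a² ≤ ad ≤ g + a²/4. Together 27a³ ≤ 64, so a = 1.
  have i1 : 3 * g ^ 2 ≤ 4 * a := by nlinarith
  have i2 : 3 * a ^ 2 ≤ 4 * g := by nlinarith
  have a1 : a = 1 := by
    by_contra hne
    have a2 : 2 ≤ a := by omega
    have i3 : (3 * a ^ 2) ^ 2 ≤ (4 * g) ^ 2 := pow_le_pow_left₀ (by positivity) i2 2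
    have i4 : a * (27 * a ^ 3) ≤ a * 64 := by nlinarith
    have i5 := le_of_mul_le_mul_left i4 ha
    have i6 : 2 ^ 3 ≤ a ^ 3 := pow_le_pow_left₀ (by norm_num) a2 3
    omega
  have g1 : g = 1 := by nlinarith
  subst a1
  have b0 : b = 0 := by rw [abs_le] at hb; omega
  subst b0
  have e0 : e = 0 := by rw [abs_le, g1] at hg; omega
  subst e0
  have d1 : d = 1 := by linarith
  have f1 : f = 1 + c ^ 2 := by rw [g1] at hm; linarith
  subst d1 f1
  exact ⟨x + c * z, y, z, by linear_combination h4⟩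

/-- Lexicographic descent on `a` and the leading minor: the shears fix both, `swap_left` lowers `a`,
and `swap_right` keeps `a` and lowers the minor. -/
theorem UnimodularTernaryRep.isSumThreeSq {n a b c d e f : ℤ}
    (h : UnimodularTernaryRep n a b c d e f) : IsSumThreeSq n := by
  induction hA : a.toNat using Nat.strong_induction_on generalizing a b c d e f with
  | _ A ihA =>
  induction hG : (a * d - b ^ 2).toNat using Nat.strong_induction_on generalizing a b c d e f with
  | _ G ihG =>
  obtain ⟨k, hk⟩ := Int.exists_abs_two_mul_add_mul_le h.pos b
  have h1 := h.shear_left k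
  have hg1 : a * (d + 2 * k * b + k ^ 2 * a) - (b + k * a) ^ 2 = a * d - b ^ 2 := by ring
  rw [← hg1] at hG
  generalize d + 2 * k * b + k ^ 2 * a = d' at *
  generalize b + k * a = b' at *
  generalize e + k * c = e' at *
  obtain ⟨l, hl⟩ := Int.exists_abs_two_mul_add_mul_le h1.minor_pos (a * e' - b' * c)
  have h2 := h1.shear_right l
  have hg2 : a * (e' + l * d') - b' * (c + l * b')
    = a * e' - b' * c + l * (a * d' - b' ^ 2) := by ring
  rw [← hg2] at hl
  generalize f + 2 * l * e' + l ^ 2 * d' = f' at *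
  generalize c + l * b' = c' at *
  generalize e' + l * d' = e'' at *
  have p1 := h2.pos
  have p2 := h2.minor_pos
  by_cases had : a ≤ d'
  · by_cases hgg : a * d' - b' ^ 2 ≤ a * f' - c' ^ 2
    · exact h2.isSumThreeSq_of_reduced hk had hl hgg
    · exact ihG _ (by omega) h2.swap_right hA rfl
  · exact ihA _ (by omega) h2.swap_left rfl

/-! ### Three squares from Dirichlet's theorem and reciprocity -/

/-- If `-d` is a square modulo `d * n - 1`, then `n` is a sum of three squares. -/
theorem isSumThreeSq_of_dvd {n d t : ℤ} (hd : 0 < d) (hdn : 0 < d * n - 1)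
    (h : d * n - 1 ∣ t ^ 2 + d) : IsSumThreeSq n := by
  obtain ⟨a, ha⟩ := h
  have ha0 : 0 < a := pos_of_mul_pos_right (ha ▸ by positivity) hdn.le
  -- The leading minor is `d`, and the third basis vector has value `n`.
  have hr : UnimodularTernaryRep n a t 1 (d * n - 1) 0 n :=
    ⟨ha0, by linarith, by linear_combination -n * ha, 0, 0, 1, by ring⟩
  exact hr.isSumThreeSq

open NumberTheorySymbols in
theorem jacobiSym_neg_eq_one_of_reciprocity {p d : ℕ} (hJ : J(p | d) = 1)
    (h : p % 4 = 1 ∧ d % 2 = 1 ∨ p % 4 = 3 ∧ d % 4 = 3) : J(-d | p) = 1 := by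
  have hp : Odd p := Nat.odd_iff.2 (by omega)
  have hd : Odd d := Nat.odd_iff.2 (by omega)
  rw [jacobiSym.neg _ hp]
  rcases h with ⟨h1, h2⟩ | ⟨h1, h2⟩
  · rw [ZMod.χ₄_nat_one_mod_four h1, ← jacobiSym.quadratic_reciprocity_one_mod_four h1 hd, hJ]
    norm_num
  · rw [ZMod.χ₄_nat_three_mod_four h1, jacobiSym.quadratic_reciprocity_three_mod_four h2 h1, hJ]
    norm_num

open NumberTheorySymbols in
theorem exists_dvd_sq_add_of_jacobiSym {p d : ℕ} (hp : p.Prime) (h : J(-d | p) = 1) :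
    ∃ t : ℤ, (p : ℤ) ∣ t ^ 2 + d := by
  have := Fact.mk hp
  obtain ⟨r, hr⟩ := ZMod.isSquare_of_jacobiSym_eq_one h
  obtain ⟨t, rfl⟩ := ZMod.intCast_surjective r
  refine ⟨t, (ZMod.intCast_zmod_eq_zero_iff_dvd _ p).1 ?_⟩
  push_cast at hr ⊢
  linear_combination -hr

theorem exists_prime_eq_mul_add {q r : ℕ} (hq : q ≠ 0) (h : r.Coprime q) :
    ∃ p j : ℕ, p.Prime ∧ p = q * j + r := by
  have := NeZero.mk hq
  obtain ⟨p, hpr, hp, hmod⟩ := Nat.forall_exists_prime_gt_and_eq_mod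
    ((ZMod.isUnit_iff_coprime r q).2 h) r
  rw [ZMod.natCast_eq_natCast_iff] at hmod
  obtain ⟨j, hj⟩ := (Nat.modEq_iff_dvd' hpr.le).1 hmod.symm
  exact ⟨p, j, hp, by omega⟩

open NumberTheorySymbols in
-- Take p = dn - 1 prime with d = 4j + 1. Then p ≡ -1 mod d gives (p|d) = 1, and reciprocity gives
-- (-d|p) = 1.
theorem isSumThreeSq_of_mod_four_eq_two {n : ℕ} (hn : n % 4 = 2) : IsSumThreeSq n := by
  have hcop : (n - 1).Coprime (4 * n) := by
    refine Nat.Coprime.mul_right ?_ ?_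
    · exact Nat.Coprime.pow_right 2
        (Nat.coprime_two_right.2 (Nat.odd_iff.2 (by omega)) : (n - 1).Coprime 2)
    · have := Nat.coprime_self_add_right (m := n - 1) (n := 1)
      rw [Nat.sub_add_cancel (by omega)] at this
      exact this.2 (Nat.coprime_one_right _)
  obtain ⟨p, j, hp, hpj⟩ := exists_prime_eq_mul_add (by omega) hcop
  have hpd : (p : ℤ) = ((4 * j + 1 : ℕ) : ℤ) * n - 1 := by
    rw [hpj]; push_cast [Nat.cast_sub (show 1 ≤ n by omega)]; ring
  have hp4 : p % 4 = 1 := by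
    rw [hpj, mul_assoc]; omega
  have hJ : J(p | 4 * j + 1) = 1 := by
    have : (p : ℤ) ≡ -1 [ZMOD (4 * j + 1 : ℕ)] :=
      Int.modEq_iff_dvd.2 ⟨-n, by linear_combination -hpd⟩
    rw [jacobiSym.mod_left' this, jacobiSym.at_neg_one (Nat.odd_iff.2 (by omega)),
      ZMod.χ₄_nat_one_mod_four (by omega)]
  obtain ⟨t, ht⟩ := exists_dvd_sq_add_of_jacobiSym hp
    (jacobiSym_neg_eq_one_of_reciprocity hJ (Or.inl ⟨hp4, by omega⟩))
  have hp0 : (0 : ℤ) < p := by exact_mod_cast hp.pos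
  rw [hpd] at ht hp0
  exact isSumThreeSq_of_dvd (by positivity) hp0 ht

open NumberTheorySymbols in
-- Here dn - 1 = 2p with d = 8j + c. Then (p|d) = (-2|d) = 1, as d is 1 or 3 mod 8.
theorem isSumThreeSq_of_odd_aux {n c : ℕ}
    (h : n % 8 = 1 ∧ c = 3 ∨ n % 8 = 3 ∧ c = 1 ∨ n % 8 = 5 ∧ c = 3) : IsSumThreeSq n := by
  obtain ⟨r, hr⟩ : ∃ r, 2 * r + 1 = c * n :=
    ⟨(c * n - 1) / 2, by rcases h with ⟨h, rfl⟩ | ⟨h, rfl⟩ | ⟨h, rfl⟩ <;> omega⟩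
  have hr4 : r % 4 = 1 ∨ r % 4 = 3 ∧ c = 3 := by
    rcases h with ⟨h, rfl⟩ | ⟨h, rfl⟩ | ⟨h, rfl⟩ <;> omega
  have hc : c = 1 ∨ c = 3 := by omega
  have hcop : r.Coprime (4 * n) := by
    refine Nat.Coprime.mul_right ?_ ?_
    · exact Nat.Coprime.pow_right 2
        (Nat.coprime_two_right.2 (Nat.odd_iff.2 (by omega)) : r.Coprime 2)
    · refine Nat.Coprime.coprime_dvd_right (Dvd.intro_left c hr.symm) ?_
      simp
  obtain ⟨p, j, hp, hpj⟩ := exists_prime_eq_mul_add (by omega) hcop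
  have hpd : 2 * (p : ℤ) = ((8 * j + c : ℕ) : ℤ) * n - 1 := by
    have : (2 * r + 1 : ℤ) = c * n := by exact_mod_cast hr
    rw [hpj]; push_cast; linear_combination this
  have hp4 : p % 4 = r % 4 := by
    rw [hpj, mul_assoc]; omega
  have hJ : J(p | 8 * j + c) = 1 := by
    have h1 : (-2 * p : ℤ) ≡ 1 [ZMOD (8 * j + c : ℕ)] :=
      Int.modEq_iff_dvd.2 ⟨n, by linear_combination hpd⟩
    have h2 := jacobiSym.mul_left (-2) p (8 * j + c)
    rw [jacobiSym.mod_left' h1, jacobiSym.one_left,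
      jacobiSym.at_neg_two (Nat.odd_iff.2 (by omega)), ZMod.χ₈'_nat_eq_if_mod_eight,
      if_neg (by omega), if_pos (by omega), one_mul] at h2
    exact h2.symm
  obtain ⟨t, ht⟩ := exists_dvd_sq_add_of_jacobiSym hp
    (jacobiSym_neg_eq_one_of_reciprocity hJ (by omega))
  have hp0 : (0 : ℤ) < 2 * p := by have := hp.pos; positivity
  -- Shifting the root by the odd `p` makes it odd, so that 2 divides u² + d as well.
  obtain ⟨u, hu, hu2⟩ : ∃ u : ℤ, (p : ℤ) ∣ u ^ 2 + (8 * j + c : ℕ) ∧ Odd u := by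
    rcases Int.even_or_odd t with hev | hodd
    · refine ⟨t + p, ?_, hev.add_odd ?_⟩
      · obtain ⟨w, hw⟩ := ht
        exact ⟨w + 2 * t + p, by linear_combination hw⟩
      · exact_mod_cast Nat.odd_iff.2 (by omega)
    · exact ⟨t, ht, hodd⟩
  have h2p : 2 * (p : ℤ) ∣ u ^ 2 + (8 * j + c : ℕ) := by
    refine IsCoprime.mul_dvd ?_ ?_ hu
    · exact_mod_cast (Nat.coprime_two_left.2 (Nat.odd_iff.2 (by omega)) : Nat.Coprime 2 p)
    · refine even_iff_two_dvd.1 (hu2.pow.add_odd ?_)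
      exact_mod_cast Nat.odd_iff.2 (by omega)
  rw [hpd] at h2p hp0
  exact isSumThreeSq_of_dvd (Nat.cast_pos.2 (by omega)) hp0 h2p

/-- The cases of the Gauss–Legendre three squares theorem in which `4` does not divide `n`. -/
theorem isSumThreeSq_of_mod_eight {n : ℤ} (hn : 0 ≤ n)
    (h : n % 4 = 1 ∨ n % 4 = 2 ∨ n % 8 = 3) : IsSumThreeSq n := by
  lift n to ℕ using hn
  rcases (by omega : n % 4 = 2 ∨ n % 8 = 1 ∨ n % 8 = 3 ∨ n % 8 = 5) with h | h | h | h
  · exact isSumThreeSq_of_mod_four_eq_two h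
  · exact isSumThreeSq_of_odd_aux (Or.inl ⟨h, rfl⟩)
  · exact isSumThreeSq_of_odd_aux (Or.inr (Or.inl ⟨h, rfl⟩))
  · exact isSumThreeSq_of_odd_aux (Or.inr (Or.inr ⟨h, rfl⟩))

/-! ### Representations with entries prime to 3 -/

theorem Int.sq_emod_four (x : ℤ) : x ^ 2 % 4 = x % 2 := by
  rcases Int.even_or_odd' x with ⟨k, rfl | rfl⟩ <;> ring_nf <;> omega

theorem Int.sq_emod_eight_of_odd {x : ℤ} (hx : Odd x) : x ^ 2 % 8 = 1 := by
  have := Int.eight_dvd_sq_sub_one_of_odd hx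
  omega

theorem Int.sq_emod_three (x : ℤ) : x ^ 2 % 3 = 0 ∧ x % 3 = 0 ∨ x ^ 2 % 3 = 1 ∧ x % 3 ≠ 0 := by
  obtain ⟨k, hk⟩ : ∃ k, x = 3 * k ∨ x = 3 * k + 1 ∨ x = 3 * k + 2 := ⟨x / 3, by omega⟩
  rcases hk with rfl | rfl | rfl <;> ring_nf <;> omega

/-- Reflecting a vector not divisible by three in the plane orthogonal to `(1, 1, 1)`, after a
suitable change of signs, makes three times it a vector of entries not divisible by three. -/
theorem exists_nine_mul_eq {x y z : ℤ} (h : ¬ (x % 3 = 0 ∧ y % 3 = 0 ∧ z % 3 = 0)) :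
    ∃ u v w : ℤ, 9 * (x ^ 2 + y ^ 2 + z ^ 2) = u ^ 2 + v ^ 2 + w ^ 2 ∧
      u % 3 ≠ 0 ∧ v % 3 ≠ 0 ∧ w % 3 ≠ 0 := by
  have key : ∀ a b c : ℤ, (a + b + c) % 3 ≠ 0 →
      ∃ u v w : ℤ, 9 * (a ^ 2 + b ^ 2 + c ^ 2) = u ^ 2 + v ^ 2 + w ^ 2 ∧
        u % 3 ≠ 0 ∧ v % 3 ≠ 0 ∧ w % 3 ≠ 0 := fun a b c habc =>
    -- Each entry is congruent to a + b + c mod 3.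
    ⟨a - 2 * b - 2 * c, b - 2 * a - 2 * c, c - 2 * a - 2 * b, by ring, by omega, by omega,
      by omega⟩
  by_cases h1 : (x + y + z) % 3 = 0
  · by_cases h2 : x % 3 = 0
    · have := key x y (-z) (by omega)
      rwa [neg_sq] at this
    · have := key (-x) y z (by omega)
      rwa [neg_sq] at this
  · exact key x y z h1

/-- If 3 divides all entries, divide `n` by 9, apply induction, and return by the reflection. -/
theorem IsSumThreeSq.exists_not_three_dvd {n : ℤ} (h : IsSumThreeSq n) (hn : 0 < n) :
    ∃ x y z : ℤ, n = x ^ 2 + y ^ 2 + z ^ 2 ∧ ¬ (x % 3 = 0 ∧ y % 3 = 0 ∧ z % 3 = 0) := by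
  induction hN : n.toNat using Nat.strong_induction_on generalizing n with
  | _ N ih =>
  obtain ⟨x, y, z, hxyz⟩ := h
  by_cases h3 : x % 3 = 0 ∧ y % 3 = 0 ∧ z % 3 = 0
  · obtain ⟨⟨x, rfl⟩, ⟨y, rfl⟩, ⟨z, rfl⟩⟩ :=
      And.imp Int.dvd_of_emod_eq_zero (And.imp Int.dvd_of_emod_eq_zero Int.dvd_of_emod_eq_zero) h3
    have hm : n = 9 * (x ^ 2 + y ^ 2 + z ^ 2) := by rw [hxyz]; ring
    obtain ⟨x', y', z', he, hne⟩ := ih _ (by omega) ⟨x, y, z, rfl⟩ (by omega) rfl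
    obtain ⟨u, v, w, hu, hne'⟩ := exists_nine_mul_eq hne
    exact ⟨u, v, w, by rw [hm, he, hu], fun H => hne'.1 H.1⟩
  · exact ⟨x, y, z, hxyz, h3⟩

theorem IsSumThreeSq.exists_coprime_three {n : ℤ} (h : IsSumThreeSq n) (hn : 0 < n)
    (h3 : n % 3 = 0) :
    ∃ x y z : ℤ, n = x ^ 2 + y ^ 2 + z ^ 2 ∧ x % 3 ≠ 0 ∧ y % 3 ≠ 0 ∧ z % 3 ≠ 0 := by
  obtain ⟨x, y, z, hxyz, hne⟩ := h.exists_not_three_dvd hn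
  have hx := Int.sq_emod_three x
  have hy := Int.sq_emod_three y
  have hz := Int.sq_emod_three z
  exact ⟨x, y, z, hxyz, by omega⟩

/-! ### Quotients by `a` -/

theorem Int.floor_intCast_div_eq {K a n : ℤ} (ha : 0 < a) (h1 : a * n ≤ K) (h2 : K < a * n + a) :
    ⌊(K : ℚ) / (a : ℚ)⌋ = n := by
  have ha' : (0 : ℚ) < a := by exact_mod_cast ha
  rw [Int.floor_eq_iff, le_div_iff₀ ha', div_lt_iff₀ ha']
  constructor
  · rw [mul_comm]; exact_mod_cast h1
  · have : (K : ℚ) < a * n + a := by exact_mod_cast h2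
    linarith

/-- A nonnegative integer-valued function whose values meet every interval `[a * n, a * n + a)` has
all natural numbers as the floors of its quotients by `a`. -/
theorem setOf_floor_div_eq_range {F : ℤ → ℤ → ℤ → ℤ} {a : ℤ} (ha : 0 < a)
    (h0 : ∀ x y z, 0 ≤ F x y z)
    (h : ∀ n : ℕ, ∃ x y z, a * n ≤ F x y z ∧ F x y z < a * n + a) :
    {m : ℤ | ∃ x y z : ℤ, m = ⌊(F x y z : ℚ) / (a : ℚ)⌋} = Set.range (fun n : ℕ => (n : ℤ)) := by
  ext m
  constructor
  · rintro ⟨x, y, z, rfl⟩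
    have h1 : (0 : ℚ) ≤ F x y z := by exact_mod_cast h0 x y z
    have h2 : (0 : ℚ) < a := by exact_mod_cast ha
    exact ⟨_, Int.toNat_of_nonneg (Int.floor_nonneg.2 (by positivity))⟩
  · rintro ⟨n, rfl⟩
    obtain ⟨x, y, z, h1, h2⟩ := h n
    exact ⟨x, y, z, (Int.floor_intCast_div_eq ha h1 h2).symm⟩

theorem exists_isSumThreeSq_mem_Ico {a : ℤ} (ha : 1 < a) (n : ℕ) :
    ∃ k, IsSumThreeSq k ∧ a * n ≤ k ∧ k < a * n + a := by
  have h0 : 0 ≤ a * n := by positivity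
  obtain ⟨k, h1, h2, h3⟩ : ∃ k, a * n ≤ k ∧ k < a * n + a ∧
      (k % 4 = 1 ∨ k % 4 = 2 ∨ k % 8 = 3) := by
    -- The bad classes mod 8 are 0, 4, 7: never three in a row, and never two starting at an even
    -- number.
    by_contra! H
    have i0 := H (a * n) le_rfl (by omega)
    have i1 := H (a * n + 1) (by omega) (by omega)
    rcases (Int.add_one_le_iff.2 ha).eq_or_lt with rfl | ha
    · omega
    · have i2 := H (a * n + 2) (by omega) (by omega)
      omega
  exact ⟨k, isSumThreeSq_of_mod_eight (by omega) h3, h1, h2⟩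

/-- Gauss's theorem that every natural number is a sum of three triangular numbers. -/
theorem exists_sum_three_mul_add_one {m : ℤ} (hm : 0 ≤ m) :
    ∃ x y z : ℤ, x * (x + 1) + y * (y + 1) + z * (z + 1) = 2 * m := by
  obtain ⟨u, v, w, h⟩ := isSumThreeSq_of_mod_eight (n := 8 * m + 3) (by omega) (by omega)
  have hu := Int.sq_emod_four u
  have hv := Int.sq_emod_four v
  have hw := Int.sq_emod_four w
  obtain ⟨x, rfl⟩ := Int.odd_iff.2 (show u % 2 = 1 by omega)
  obtain ⟨y, rfl⟩ := Int.odd_iff.2 (show v % 2 = 1 by omega)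
  obtain ⟨z, rfl⟩ := Int.odd_iff.2 (show w % 2 = 1 by omega)
  exact ⟨x, y, z, by linarith⟩

theorem Int.mul_add_one_nonneg (x : ℤ) : 0 ≤ x * (x + 1) := by
  rcases le_or_gt 0 x with h | h <;> nlinarith

theorem setOf_floor_sum_sq_div {a : ℤ} (ha : 1 < a) :
    {m : ℤ | ∃ x y z : ℤ, m = ⌊((x : ℚ) ^ 2 + (y : ℚ) ^ 2 + (z : ℚ) ^ 2) / (a : ℚ)⌋}
      = Set.range (fun n : ℕ => (n : ℤ)) := by
  have := setOf_floor_div_eq_range (F := fun x y z => x ^ 2 + y ^ 2 + z ^ 2) (a := a) (by omega)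
    (fun x y z => by positivity) fun n => by
      obtain ⟨_, ⟨x, y, z, rfl⟩, h⟩ := exists_isSumThreeSq_mem_Ico ha n
      exact ⟨x, y, z, h⟩
  push_cast at this
  exact this

theorem setOf_floor_sum_mul_add_one_div {a : ℤ} (ha : 1 < a) :
    {m : ℤ | ∃ x y z : ℤ,
        m = ⌊((x : ℚ) * (x + 1) + (y : ℚ) * (y + 1) + (z : ℚ) * (z + 1)) / (a : ℚ)⌋}
      = Set.range (fun n : ℕ => (n : ℤ)) := by
  have := setOf_floor_div_eq_range (a := a)
    (F := fun x y z => x * (x + 1) + y * (y + 1) + z * (z + 1)) (by omega)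
    (fun x y z => by
      have := x.mul_add_one_nonneg
      have := y.mul_add_one_nonneg
      have := z.mul_add_one_nonneg
      positivity) fun n => by
      have h0 : 0 ≤ a * n := by positivity
      obtain ⟨x, y, z, h⟩ := exists_sum_three_mul_add_one (m := (a * n + 1) / 2) (by omega)
      exact ⟨x, y, z, by omega, by omega⟩
  push_cast at this
  exact this

/-! ### Sums with linear terms -/

theorem exists_sum_sq_add_floor_half {a : ℤ} (ha : Odd a) (n : ℕ) :
    ∃ x y z : ℤ, (n : ℤ) = x ^ 2 + y ^ 2 + z ^ 2 + ⌊(a : ℚ) / 2 * ((x : ℚ) + y + z)⌋ := by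
  have hsq : ∀ u : ℤ, u % 2 = 1 → ∃ x : ℤ, u ^ 2 = (4 * x + a) ^ 2 := by
    intro u hu
    rw [Int.odd_iff] at ha
    rcases (by omega : (u - a) % 4 = 0 ∨ (-u - a) % 4 = 0) with h | h
    · exact ⟨(u - a) / 4, by congr 1; omega⟩
    · exact ⟨(-u - a) / 4, by rw [← neg_sq]; congr 1; omega⟩
  have h8 : a ^ 2 % 8 = 1 := Int.sq_emod_eight_of_odd ha
  -- Equals Σ(4x + a)² exactly when Σx² + (a/2)Σx = n, so the floor rounds nothing.
  obtain ⟨u, v, w, h⟩ := isSumThreeSq_of_mod_eight (n := 16 * n + 3 * a ^ 2) (by positivity)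
    (by omega)
  have hu := Int.sq_emod_four u
  have hv := Int.sq_emod_four v
  have hw := Int.sq_emod_four w
  obtain ⟨x, hx⟩ := hsq u (by omega)
  obtain ⟨y, hy⟩ := hsq v (by omega)
  obtain ⟨z, hz⟩ := hsq w (by omega)
  rw [hx, hy, hz] at h
  refine ⟨x, y, z, ?_⟩
  have hf : (a : ℚ) / 2 * ((x : ℚ) + y + z) = ((a * (x + y + z) : ℤ) : ℚ) / ((2 : ℤ) : ℚ) := by
    push_cast; ring
  rw [hf, Int.floor_intCast_div_eq (n := n - (x ^ 2 + y ^ 2 + z ^ 2)) (by norm_num)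
    (by linarith) (by linarith)]
  ring

theorem floor_third_of_eq {a n r x y z : ℤ} (hr0 : 0 ≤ r) (hr3 : r < 3)
    (h : 3 * (x ^ 2 + y ^ 2 + z ^ 2) + a * (x + y + z) = 3 * n + r) :
    n = x ^ 2 + y ^ 2 + z ^ 2 + ⌊(a : ℚ) / 3 * ((x : ℚ) + y + z)⌋ := by
  have hf : (a : ℚ) / 3 * ((x : ℚ) + y + z) = ((a * (x + y + z) : ℤ) : ℚ) / ((3 : ℤ) : ℚ) := by
    push_cast; ring
  rw [hf, Int.floor_intCast_div_eq (n := n - (x ^ 2 + y ^ 2 + z ^ 2)) (by norm_num)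
    (by linarith) (by linarith)]
  ring

theorem exists_sum_sq_add_floor_third {a : ℤ} (ha : ¬ (3 : ℤ) ∣ a) (n : ℕ) :
    ∃ x y z : ℤ, (n : ℤ) = x ^ 2 + y ^ 2 + z ^ 2 + ⌊(a : ℚ) / 3 * ((x : ℚ) + y + z)⌋ := by
  have ha3 : a % 3 ≠ 0 := fun h => ha (Int.dvd_of_emod_eq_zero h)
  rcases Int.even_or_odd' a with ⟨b, rfl | rfl⟩
  · have hsq : ∀ u : ℤ, u % 3 ≠ 0 → ∃ x : ℤ, u ^ 2 = (3 * x + b) ^ 2 := by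
      intro u hu
      have h1 : u % 3 = 1 ∨ u % 3 = 2 := by omega
      have h2 : b % 3 = 1 ∨ b % 3 = 2 := by omega
      have h3 : (u - b) % 3 = 0 ∨ (-u - b) % 3 = 0 := by
        rcases h1 with h1 | h1 <;> rcases h2 with h2 | h2 <;> omega
      rcases h3 with h | h
      · exact ⟨(u - b) / 3, by congr 1; omega⟩
      · exact ⟨(-u - b) / 3, by rw [← neg_sq]; congr 1; omega⟩
    have hb : 0 < b ^ 2 := by
      have : b ≠ 0 := by omega
      positivity
    -- Three distinct classes mod 4 cannot all lie in {0, 3}.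
    obtain ⟨r, hr0, hr3, hr⟩ : ∃ r : ℤ, 0 ≤ r ∧ r < 3 ∧
        ((9 * n + 3 * r + 3 * b ^ 2) % 4 = 1 ∨ (9 * n + 3 * r + 3 * b ^ 2) % 4 = 2) := by
      by_contra! H
      have i0 := H 0 (by norm_num) (by norm_num)
      have i1 := H 1 (by norm_num) (by norm_num)
      have i2 := H 2 (by norm_num) (by norm_num)
      omega
    obtain ⟨u, v, w, h, hu, hv, hw⟩ := (isSumThreeSq_of_mod_eight
      (n := 9 * n + 3 * r + 3 * b ^ 2) (by positivity) (by tauto)).exists_coprime_three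
      (by positivity) (by omega)
    obtain ⟨x, hx⟩ := hsq u hu
    obtain ⟨y, hy⟩ := hsq v hv
    obtain ⟨z, hz⟩ := hsq w hw
    rw [hx, hy, hz] at h
    exact ⟨x, y, z, floor_third_of_eq hr0 hr3 (by linarith)⟩
  · set a := 2 * b + 1 with hab
    have hsq : ∀ u : ℤ, u % 2 = 1 → u % 3 ≠ 0 → ∃ x : ℤ, u ^ 2 = (6 * x + a) ^ 2 := by
      intro u hu hu'
      have h1 : u % 6 = 1 ∨ u % 6 = 5 := by omega
      have h2 : a % 6 = 1 ∨ a % 6 = 5 := by omega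
      have h3 : (u - a) % 6 = 0 ∨ (-u - a) % 6 = 0 := by
        rcases h1 with h1 | h1 <;> rcases h2 with h2 | h2 <;> omega
      rcases h3 with h | h
      · exact ⟨(u - a) / 6, by congr 1; omega⟩
      · exact ⟨(-u - a) / 6, by rw [← neg_sq]; congr 1; omega⟩
    have ha0 : 0 < a ^ 2 := by
      have : a ≠ 0 := by omega
      positivity
    have h8 : a ^ 2 % 8 = 1 := Int.sq_emod_eight_of_odd ⟨b, hab⟩
    obtain ⟨r, hr0, hr3, hr⟩ : ∃ r : ℤ, 0 ≤ r ∧ r < 3 ∧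
        (36 * n + 12 * r + 3 * a ^ 2) % 8 = 3 :=
      ⟨n % 2, by omega, by omega, by omega⟩
    obtain ⟨u, v, w, h, hu, hv, hw⟩ := (isSumThreeSq_of_mod_eight
      (n := 36 * n + 12 * r + 3 * a ^ 2) (by positivity) (by tauto)).exists_coprime_three
      (by positivity) (by omega)
    have hu' := Int.sq_emod_four u
    have hv' := Int.sq_emod_four v
    have hw' := Int.sq_emod_four w
    obtain ⟨x, hx⟩ := hsq u (by omega) hu
    obtain ⟨y, hy⟩ := hsq v (by omega) hv
    obtain ⟨z, hz⟩ := hsq w (by omega) hw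
    rw [hx, hy, hz] at h
    exact ⟨x, y, z, floor_third_of_eq hr0 hr3 (by linarith)⟩

/-! ### Halved octagonal numbers -/

theorem Int.ceil_intCast_div_two (k : ℤ) : ⌈(k : ℚ) / 2⌉ = (k + 1) / 2 := by
  have h := Int.emod_add_mul_ediv (k + 1) 2
  have h' : ((k + 1) % 2 : ℤ) + 2 * ((k + 1) / 2 : ℤ) = (k + 1 : ℚ) := by exact_mod_cast h
  rw [Int.ceil_eq_iff]
  rcases Int.emod_two_eq_zero_or_one (k + 1) with h0 | h0 <;> rw [h0] at h' <;> push_cast at h' <;>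
    constructor <;> linarith

theorem three_mul_p8_add_one (x : ℤ) : 3 * p8 x + 1 = (3 * x - 1) ^ 2 := by
  unfold p8; ring

theorem p8_nonneg (x : ℤ) : 0 ≤ p8 x := by
  have := three_mul_p8_add_one x
  have := sq_nonneg (3 * x - 1)
  omega

theorem exists_six_mul_ceil_half_p8 {u : ℤ} (hu : u % 3 ≠ 0) :
    ∃ x : ℤ, 6 * ⌈(p8 x : ℚ) / 2⌉ = u ^ 2 - 1 + 3 * ((u + 1) % 2) ∧
      (Odd u → Even (p8 x)) := by
  obtain ⟨x, hx⟩ : ∃ x : ℤ, (3 * x - 1) ^ 2 = u ^ 2 := by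
    rcases (by omega : (u + 1) % 3 = 0 ∨ (-u + 1) % 3 = 0) with h | h
    · exact ⟨(u + 1) / 3, by congr 1; omega⟩
    · exact ⟨(-u + 1) / 3, by rw [← neg_sq u]; congr 1; omega⟩
  have h1 := three_mul_p8_add_one x
  have h2 := u.sq_emod_four
  refine ⟨x, by rw [Int.ceil_intCast_div_two]; omega, fun h => ?_⟩
  rw [Int.odd_iff] at h
  rw [Int.even_iff]
  omega

theorem exists_sq_sum_odd (n : ℕ) : ∃ u v w : ℤ, u % 3 ≠ 0 ∧ v % 3 ≠ 0 ∧ w % 3 ≠ 0 ∧ Odd u ∧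
    u ^ 2 + v ^ 2 + w ^ 2 + 3 * ((v + 1) % 2) + 3 * ((w + 1) % 2) = 6 * n + 3 := by
  rcases n.eq_zero_or_pos with rfl | hn
  · exact ⟨1, 1, 1, by norm_num⟩
  -- For odd `n`, N ≡ 2 mod 4 forces one even entry, adding 3; for even `n`, N ≡ 1 forces two,
  -- adding 6.
  obtain ⟨N, hN, hN0, hmod⟩ : ∃ N : ℤ, (n % 2 = 1 ∧ N = 6 * n ∨ n % 2 = 0 ∧ N = 6 * n - 3) ∧
      0 < N ∧ (N % 4 = 1 ∨ N % 4 = 2) := by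
    rcases Nat.mod_two_eq_zero_or_one n with h | h
    · exact ⟨6 * n - 3, by omega, by omega, by omega⟩
    · exact ⟨6 * n, by omega, by omega, by omega⟩
  obtain ⟨u, v, w, h, hu, hv, hw⟩ := (isSumThreeSq_of_mod_eight hN0.le
    (by tauto)).exists_coprime_three hN0 (by omega)
  have hu' := Int.sq_emod_four u
  have hv' := Int.sq_emod_four v
  have hw' := Int.sq_emod_four w
  simp only [Int.odd_iff]
  by_cases h1 : u % 2 = 1
  · exact ⟨u, v, w, hu, hv, hw, h1, by omega⟩
  · by_cases h2 : v % 2 = 1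
    · exact ⟨v, u, w, hv, hu, hw, h2, by omega⟩
    · exact ⟨w, u, v, hw, hu, hv, by omega, by omega⟩

theorem exists_sum_half_p8 (n : ℕ) : ∃ x y z : ℤ, Even (p8 x) ∧
    (n : ℤ) = ⌈(p8 x : ℚ) / 2⌉ + ⌈(p8 y : ℚ) / 2⌉ + ⌈(p8 z : ℚ) / 2⌉ := by
  obtain ⟨u, v, w, hu, hv, hw, hodd, h⟩ := exists_sq_sum_odd n
  obtain ⟨x, hx, hev⟩ := exists_six_mul_ceil_half_p8 hu
  obtain ⟨y, hy, -⟩ := exists_six_mul_ceil_half_p8 hv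
  obtain ⟨z, hz, -⟩ := exists_six_mul_ceil_half_p8 hw
  refine ⟨x, y, z, hev hodd, ?_⟩
  rw [Int.odd_iff] at hodd
  omega

theorem sFun_eq (x : ℤ) : sFun x = x + ⌈(3 / 2 : ℚ) * (x : ℚ) ^ 2⌉ := by
  have h : (p8 (-x) : ℚ) / 2 = (3 / 2 : ℚ) * (x : ℚ) ^ 2 + x := by
    unfold p8; push_cast; ring
  rw [sFun, h, Int.ceil_add_intCast, add_comm]

theorem sFun_nonneg (x : ℤ) : 0 ≤ sFun x := by
  have := p8_nonneg (-x)
  rw [sFun, Int.ceil_intCast_div_two]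
  omega

theorem setOf_sum_sFun : {m : ℤ | ∃ x y z : ℤ, m = sFun x + sFun y + sFun z}
    = Set.range (fun n : ℕ => (n : ℤ)) := by
  ext m
  constructor
  · rintro ⟨x, y, z, rfl⟩
    have := sFun_nonneg x
    have := sFun_nonneg y
    have := sFun_nonneg z
    exact ⟨_, Int.toNat_of_nonneg (by positivity)⟩
  · rintro ⟨n, rfl⟩
    obtain ⟨x, y, z, -, h⟩ := exists_sum_half_p8 n
    exact ⟨-x, -y, -z, by simpa only [sFun, neg_neg] using h⟩

theorem theorem1p4 :
    -- Part (i)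
    (∀ a : ℤ, 1 < a →
      {m : ℤ | ∃ x y z : ℤ, m = ⌊((x : ℚ) ^ 2 + (y : ℚ) ^ 2 + (z : ℚ) ^ 2) / (a : ℚ)⌋}
          = Set.range (fun n : ℕ => (n : ℤ)) ∧
      {m : ℤ | ∃ x y z : ℤ,
          m = ⌊((x : ℚ) * (x + 1) + (y : ℚ) * (y + 1) + (z : ℚ) * (z + 1)) / (a : ℚ)⌋}
          = Set.range (fun n : ℕ => (n : ℤ))) ∧
    -- Part (ii)
    (∀ a : ℤ, 0 < a →
      (Odd a → ∀ n : ℕ, ∃ x y z : ℤ,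
        (n : ℤ) = x ^ 2 + y ^ 2 + z ^ 2 + ⌊(a : ℚ) / 2 * ((x : ℚ) + y + z)⌋) ∧
      (¬ (3 : ℤ) ∣ a → ∀ n : ℕ, ∃ x y z : ℤ,
        (n : ℤ) = x ^ 2 + y ^ 2 + z ^ 2 + ⌊(a : ℚ) / 3 * ((x : ℚ) + y + z)⌋)) ∧
    -- Part (iii)
    (∀ n : ℕ, ∃ x y z : ℤ,
      (n : ℚ) = (p8 x : ℚ) / 2 + (⌈(p8 y : ℚ) / 2⌉ : ℚ) + (⌈(p8 z : ℚ) / 2⌉ : ℚ)) ∧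
    (∀ x : ℤ, sFun x = x + ⌈(3 / 2 : ℚ) * (x : ℚ) ^ 2⌉) ∧
    {m : ℤ | ∃ x y z : ℤ, m = sFun x + sFun y + sFun z}
      = Set.range (fun n : ℕ => (n : ℤ)) := by
  refine ⟨fun a ha => ⟨setOf_floor_sum_sq_div ha, setOf_floor_sum_mul_add_one_div ha⟩,
    fun a _ => ⟨exists_sum_sq_add_floor_half, exists_sum_sq_add_floor_third⟩, fun n => ?_,
    sFun_eq, setOf_sum_sFun⟩
  obtain ⟨x, y, z, ⟨k, hk⟩, h⟩ := exists_sum_half_p8 n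
  have hx : (p8 x : ℚ) / 2 = k := by rw [hk]; push_cast; ring
  refine ⟨x, y, z, ?_⟩
  rw [hx, Int.ceil_intCast] at h
  rw [hx]
  exact_mod_cast h
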